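/- Let $m_0,m\ge 0$ be integers and consider a discrete-time Markov chain of GI/M/1 type, with $m_0$ phases in level $0$, $m$ phases in each level $k\ge1$, and transition matrix $$P=\begin{pmatrix} B_1&B_0&&&\\ B_2&A_1&A_0&&\\ B_3&A_2&A_1&A_0&\\ \vdots&\vdots&\vdots&\vdots&\ddots\end{pmatrix}.$$ Assume that $P$ is stochastic, irreducible and positive recurrent. Let $x=(x_0,x_1,x_2,\dots)$ be its stationary probability vector, partitioned by levels, let $\pi_k=\sum_{j\ge k}x_j$ for $k\ge1$, and let $R$ be the (entrywise) minimal nonnegative solution of $R=\sum_{k\ge0}R^kA_k$. Put $$\widehat\Psi=\sum_{k\ge1}R^{k-1}A_k,\qquad \widehat\Psi_0=(A_0+A_1)+\sum_{k\ge2}R\,R^{k-2}A_k,\qquad R_1=B_0(I-\widehat\Psi)^{-1},$$ $$G_j=(I-\widehat\Psi)^{-1}\sum_{k\ge j+1}R^{k-j-1}A_k\quad(j\ge1).$$ Then all the series above (including those defining $\pi_k$) converge, the matrices $I-R$, $I-\widehat\Psi$, $I-\widehat\Psi_0$ are invertible, and the following hold. (a) For all $k\ge1$, $x_k=x_0R_1R^{k-1}$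 and $$\pi_k=x_0R_1(I-R)^{-1}R^{k-1}.$$ (b) Let $$\mathbb P=\begin{pmatrix} A_0+A_1&A_0&&&\\ A_2&A_1&A_0&&\\ A_3&A_2&A_1&A_0&\\ \vdots&\vdots&\vdots&\vdots&\ddots\end{pmatrix}.$$ Then $I-\mathbb P$ has the UL-type $RG$-factorization $$I-\mathbb P=(I-R_U)(I-\Phi_D)(I-G_L),$$ where $R_U$ is the block matrix with all blocks on the first superdiagonal equal to $R$ and all other blocks $0$, $\Phi_D=\mathrm{diag}(\widehat\Psi_0,\widehat\Psi,\widehat\Psi,\dots)$, and $G_L$ is the strictly lower triangular block matrix with blocks $(G_L)_{i,j}=G_{i-j}$ for $i>j\ge0$. Moreover, for all $k\ge1$, $$\pi_k=x_0B_0(I-\widehat\Psi_0)^{-1}R^{k-1}.$$ (c) Consequently $$x_0B_0(I-\widehat\Psi_0)^{-1}=x_0R_1(I-R)^{-1}.$$ -/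

import Mathlib

open Matrix

noncomputable section

namespace GIM1

/-! ### Discrete-time Markov chains on a countable state space -/

section Chain

variable {S : Type*}

/-- `P` is a (row-)stochastic matrix. -/
def IsStochastic (P : Matrix S S ℝ) : Prop :=
  (∀ s t, 0 ≤ P s t) ∧ ∀ s, HasSum (fun t => P s t) 1

open Classical in
/-- `firstPassage P n s t` is the probability that the chain, started in `s`, visits `t` for the
first time after time `0` at time `n + 1`. -/
def firstPassage (P : Matrix S S ℝ) : ℕ → S → S → ℝ
  | 0, s, t => P s t
  | n + 1, s, t => ∑' u, if u = t then 0 else P s u * firstPassage P n u t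

/-- Positive recurrence: from each state the chain returns with probability one, and the mean
return time is finite. -/
def IsPositiveRecurrent (P : Matrix S S ℝ) : Prop :=
  ∀ s, HasSum (fun n => firstPassage P n s s) 1 ∧
    Summable (fun n : ℕ => ((n : ℝ) + 1) * firstPassage P n s s)

/-- `x` is a stationary probability vector of `P`, that is, `x ≥ 0`, `x e = 1` and `x P = x`. -/
def IsStationary (P : Matrix S S ℝ) (x : S → ℝ) : Prop :=
  (∀ s, 0 ≤ x s) ∧ HasSum x 1 ∧ ∀ t, HasSum (fun s => x s * P s t) (x t)

end Chain

variable {m₀ m : ℕ}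

/-! ### The chain of GI/M/1 type -/

/-- The states: `Sum.inl i` is phase `i` of level `0`, and `Sum.inr (n, j)` is phase `j` of
level `n + 1`. -/
abbrev State (m₀ m : ℕ) : Type := Fin m₀ ⊕ (ℕ × Fin m)

/-- The transition matrix of GI/M/1 type with block rows
`(B₁, B₀, 0, …)`, `(B₂, A₁, A₀, 0, …)`, `(B₃, A₂, A₁, A₀, 0, …)`, ….
The matrices `B k` are used for `k ≥ 2` only. -/
def transition (B₁ : Matrix (Fin m₀) (Fin m₀) ℝ) (B₀ : Matrix (Fin m₀) (Fin m) ℝ)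
    (B : ℕ → Matrix (Fin m) (Fin m₀) ℝ) (A : ℕ → Matrix (Fin m) (Fin m) ℝ) :
    Matrix (State m₀ m) (State m₀ m) ℝ
  | Sum.inl i, Sum.inl j => B₁ i j
  | Sum.inl i, Sum.inr (l, j) => if l = 0 then B₀ i j else 0
  | Sum.inr (n, i), Sum.inl j => B (n + 2) i j
  | Sum.inr (n, i), Sum.inr (l, j) => if l ≤ n + 1 then A (n + 1 - l) i j else 0

/-- The subvector `x₀` of level `0`. -/
def levelZero (x : State m₀ m → ℝ) : Fin m₀ → ℝ := fun i => x (Sum.inl i)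

/-- The subvector `x_k` of level `k`, for `k ≥ 1`. -/
def level (x : State m₀ m → ℝ) (k : ℕ) : Fin m → ℝ := fun j => x (Sum.inr (k - 1, j))

/-- The tail vector `π_k = ∑_{j ≥ k} x_j`, for `k ≥ 1`. -/
def tailVec (x : State m₀ m → ℝ) (k : ℕ) : Fin m → ℝ := ∑' n : ℕ, level x (k + n)

/-- `R` is the (entrywise) minimal nonnegative solution of `R = ∑_{k ≥ 0} R ^ k A_k`. -/
def IsMinimalSolution (A : ℕ → Matrix (Fin m) (Fin m) ℝ) (R : Matrix (Fin m) (Fin m) ℝ) : Prop :=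
  (∀ i j, 0 ≤ R i j) ∧ HasSum (fun k : ℕ => R ^ k * A k) R ∧
    ∀ X : Matrix (Fin m) (Fin m) ℝ, (∀ i j, 0 ≤ X i j) → HasSum (fun k : ℕ => X ^ k * A k) X →
      ∀ i j, R i j ≤ X i j

/-- `psiSum A R n = ∑_{k ≥ n + 1} R ^ (k - n - 1) A_k`. -/
def psiSum (A : ℕ → Matrix (Fin m) (Fin m) ℝ) (R : Matrix (Fin m) (Fin m) ℝ) (n : ℕ) :
    Matrix (Fin m) (Fin m) ℝ :=
  ∑' k : ℕ, R ^ k * A (k + n + 1)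

/-- `Ψ̂ = ∑_{k ≥ 1} R ^ (k - 1) A_k`, the `U`-measure at the levels above the lowest one. -/
def psiHat (A : ℕ → Matrix (Fin m) (Fin m) ℝ) (R : Matrix (Fin m) (Fin m) ℝ) :
    Matrix (Fin m) (Fin m) ℝ :=
  psiSum A R 0

/-- `Ψ̂₀ = (A₀ + A₁) + ∑_{k ≥ 2} R R ^ (k - 2) A_k`, the `U`-measure of `tailMatrix A` at its
lowest level. -/
def psiHatZero (A : ℕ → Matrix (Fin m) (Fin m) ℝ) (R : Matrix (Fin m) (Fin m) ℝ) :
    Matrix (Fin m) (Fin m) ℝ :=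
  (A 0 + A 1) + ∑' k : ℕ, R * R ^ k * A (k + 2)

/-- `R₁ = B₀ (I - Ψ̂)⁻¹`, the `R`-measure of the chain from level `0` to level `1`. -/
def rOne (B₀ : Matrix (Fin m₀) (Fin m) ℝ) (A : ℕ → Matrix (Fin m) (Fin m) ℝ)
    (R : Matrix (Fin m) (Fin m) ℝ) : Matrix (Fin m₀) (Fin m) ℝ :=
  B₀ * (1 - psiHat A R)⁻¹

/-! ### Infinite block matrices and the UL-type RG-factorization -/

/-- Infinite matrices of `m × m` blocks. -/
abbrev BlockMatrix (m : ℕ) : Type := Matrix ℕ ℕ (Matrix (Fin m) (Fin m) ℝ)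

/-- The product of infinite block matrices. -/
def blockMul (M N : BlockMatrix m) : BlockMatrix m := fun i j => ∑' k : ℕ, M i k * N k j

/-- The block matrix `ℙ` with block rows `(A₀ + A₁, A₀, 0, …)`, `(A₂, A₁, A₀, 0, …)`,
`(A₃, A₂, A₁, A₀, 0, …)`, …. -/
def tailMatrix (A : ℕ → Matrix (Fin m) (Fin m) ℝ) : BlockMatrix m := fun i j =>
  if i = 0 ∧ j = 0 then A 0 + A 1 else if j ≤ i + 1 then A (i + 1 - j) else 0

/-- `R_U`: the blocks just above the diagonal are `R`, all others vanish. -/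
def upperR (R : Matrix (Fin m) (Fin m) ℝ) : BlockMatrix m := fun i j =>
  if j = i + 1 then R else 0

/-- `Φ_D = diag (Ψ̂₀, Ψ̂, Ψ̂, …)`. -/
def diagPsi (A : ℕ → Matrix (Fin m) (Fin m) ℝ) (R : Matrix (Fin m) (Fin m) ℝ) : BlockMatrix m :=
  Matrix.diagonal fun i => if i = 0 then psiHatZero A R else psiHat A R

/-- `G_L`: strictly lower triangular, with block `(I - Ψ̂)⁻¹ ∑_{k ≥ n + 1} R ^ (k - n - 1) A_k`
at distance `n ≥ 1` below the diagonal. -/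
def lowerG (A : ℕ → Matrix (Fin m) (Fin m) ℝ) (R : Matrix (Fin m) (Fin m) ℝ) : BlockMatrix m :=
  fun i j => if j < i then (1 - psiHat A R)⁻¹ * psiSum A R (i - j) else 0

end GIM1

end

/-!
`R` is the limit of the iterates of `X ↦ ∑_k X ^ k A_k` started at `0`, and these iterates preserve
the inequalities `y_k X ≤ y_{k + 1}` for every nonnegative solution `y` of the balance equations
`y_{k + 1} = ∑_n y_{k + n} A_n`. Hence `y_0 R ^ k ≤ y_k`; for the stationary vector, which is
positive by irreducibility, this makes `∑_n R ^ n` converge.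

A nonnegative summable solution `y` of the balance equations with `y_0 ≤ ∑_n y_n A_{n + 1}`,
extended by `0` to level `0`, is a finite measure `d ≤ d P`. As `P` preserves total mass, `d P = d`,
and since `d` vanishes on level `0`, irreducibility forces `d = 0`. Applied to the excess of a
solution `y` over `y_0 R ^ k`, this gives the matrix-geometric form. Applied to `v R ^ k`, where
`0 ≤ v ≤ v Ψ̂`, it gives the invertibility of `I - Ψ̂`.

Finally `R = A₀ + R Ψ̂` and `Ψ̂₀ = A₀ + Ψ̂` give `I - Ψ̂₀ = (I - R) (I - Ψ̂)`, which links the two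
forms of `π_k`; the factorization follows from the recursion
`∑_{k > n} R ^ (k - n - 1) A_k = A_{n + 1} + R ∑_{k > n + 1} R ^ (k - n - 2) A_k`.
-/

namespace GIM1

open Filter Topology

/-! ### Entrywise nonnegative matrices -/

section Entrywise

variable {k l m α : Type*} [Fintype l] [Semiring α] [PartialOrder α] [IsOrderedRing α]

theorem vecMul_nonneg {v : l → α} {M : Matrix l m α} (hv : 0 ≤ v) (hM : ∀ i j, 0 ≤ M i j) :
    0 ≤ v ᵥ* M :=
  fun j => dotProduct_nonneg_of_nonneg hv fun i => hM i j

theorem vecMul_mono {v w : l → α} {M N : Matrix l m α} (hw : 0 ≤ w) (hM : ∀ i j, 0 ≤ M i j)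
    (hvw : v ≤ w) (hMN : ∀ i j, M i j ≤ N i j) : v ᵥ* M ≤ w ᵥ* N :=
  fun j => (dotProduct_le_dotProduct_of_nonneg_right hvw fun i => hM i j).trans
    (dotProduct_le_dotProduct_of_nonneg_left (fun i => hMN i j) hw)

theorem mul_apply_nonneg {M : Matrix k l α} {N : Matrix l m α} (hM : ∀ i j, 0 ≤ M i j)
    (hN : ∀ i j, 0 ≤ N i j) (i : k) (j : m) : 0 ≤ (M * N) i j :=
  vecMul_nonneg (hM i) hN j

theorem mul_apply_mono {M M' : Matrix k l α} {N N' : Matrix l m α} (hM' : ∀ i j, 0 ≤ M' i j)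
    (hN : ∀ i j, 0 ≤ N i j) (hMM' : ∀ i j, M i j ≤ M' i j) (hNN' : ∀ i j, N i j ≤ N' i j)
    (i : k) (j : m) : (M * N) i j ≤ (M' * N') i j :=
  vecMul_mono (hM' i) hN (hMM' i) hNN' j

variable [DecidableEq l]

theorem pow_apply_nonneg {M : Matrix l l α} (hM : ∀ i j, 0 ≤ M i j) (n : ℕ) :
    ∀ i j, 0 ≤ (M ^ n) i j := by
  induction n with
  | zero => intro i j; rw [pow_zero, Matrix.one_apply]; split_ifs <;> norm_num
  | succ n ih => rw [pow_succ]; exact mul_apply_nonneg ih hM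

theorem pow_apply_mono {M N : Matrix l l α} (hM : ∀ i j, 0 ≤ M i j)
    (hMN : ∀ i j, M i j ≤ N i j) (n : ℕ) : ∀ i j, (M ^ n) i j ≤ (N ^ n) i j := by
  induction n with
  | zero => simp
  | succ n ih =>
    rw [pow_succ, pow_succ]
    exact mul_apply_mono (pow_apply_nonneg (fun i j => (hM i j).trans (hMN i j)) n) hM ih hMN

theorem pow_mul_apply_mono {M N : Matrix l l α} {C : Matrix l m α} (hC : ∀ i j, 0 ≤ C i j)
    (hM : ∀ i j, 0 ≤ M i j) (hMN : ∀ i j, M i j ≤ N i j) {n : ℕ} :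
    ∀ i j, (M ^ n * C) i j ≤ (N ^ n * C) i j :=
  mul_apply_mono (pow_apply_nonneg (fun i j => (hM i j).trans (hMN i j)) n) hC
    (pow_apply_mono hM hMN n) fun _ _ => le_rfl

theorem vecMul_pow_le_of_vecMul_le_succ {M : Matrix l l α} (hM : ∀ i j, 0 ≤ M i j)
    {y : ℕ → l → α} (hy₀ : 0 ≤ y) (h : ∀ n, y n ᵥ* M ≤ y (n + 1)) (n q : ℕ) :
    y n ᵥ* M ^ q ≤ y (n + q) := by
  induction q with
  | zero => simp
  | succ q ih =>
    rw [pow_succ, ← Matrix.vecMul_vecMul]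
    exact (vecMul_mono (hy₀ (n + q)) hM ih fun _ _ => le_rfl).trans (h (n + q))

theorem exists_le_vecMul_of_not_isUnit_one_sub {α : Type*} [Field α] [LinearOrder α]
    [IsStrictOrderedRing α] {M : Matrix l l α} (hM : ∀ i j, 0 ≤ M i j) (h : ¬IsUnit (1 - M)) :
    ∃ v : l → α, 0 ≤ v ∧ v ≠ 0 ∧ v ≤ v ᵥ* M := by
  rw [Matrix.isUnit_iff_isUnit_det, isUnit_iff_ne_zero, not_not] at h
  obtain ⟨u, hu, huM⟩ := Matrix.exists_vecMul_eq_zero_iff.2 h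
  rw [Matrix.vecMul_sub, Matrix.vecMul_one, sub_eq_zero] at huM
  refine ⟨|u|, abs_nonneg u, fun hzero => hu ?_, fun j => ?_⟩
  · exact funext fun j => abs_eq_zero.1 (congrFun hzero j)
  · calc |u j| = |∑ i, u i * M i j| := congrArg abs (congrFun huM j)
      _ ≤ ∑ i, |u i * M i j| := Finset.abs_sum_le_sum_abs _ _
      _ = ∑ i, |u i| * M i j := Finset.sum_congr rfl fun i _ => by
        rw [abs_mul, abs_of_nonneg (hM i j)]

end Entrywise

/-! ### Series of vectors and matrices -/

section Sums

variable {ι k l m α : Type*}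

theorem hasSum_matrix_iff [AddCommMonoid α] [TopologicalSpace α] {f : ι → Matrix l m α}
    {a : Matrix l m α} :
    HasSum f a ↔ ∀ i j, HasSum (fun n => f n i j) (a i j) :=
  Pi.hasSum.trans (forall_congr' fun _ => Pi.hasSum)

theorem summable_matrix_iff [AddCommMonoid α] [TopologicalSpace α] {f : ι → Matrix l m α} :
    Summable f ↔ ∀ i j, Summable (fun n => f n i j) :=
  Pi.summable.trans (forall_congr' fun _ => Pi.summable)

theorem summable_matrix_of_le {f g : ι → Matrix l m ℝ} (hf : ∀ n i j, 0 ≤ f n i j)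
    (hfg : ∀ n i j, f n i j ≤ g n i j) (hg : Summable g) : Summable f :=
  summable_matrix_iff.2 fun i j => Summable.of_nonneg_of_le (fun n => hf n i j)
    (fun n => hfg n i j) (summable_matrix_iff.1 hg i j)

theorem hasSum_vecMul [Fintype l] [NonUnitalNonAssocSemiring α] [TopologicalSpace α]
    [IsTopologicalSemiring α] {f : ι → Matrix l m α} {a : Matrix l m α} (hf : HasSum f a)
    (v : l → α) : HasSum (fun n => v ᵥ* f n) (v ᵥ* a) :=
  hf.map (⟨⟨fun M => v ᵥ* M, Matrix.vecMul_zero v⟩, fun M N => Matrix.vecMul_add M N v⟩ :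
    Matrix l m α →+ (m → α)) (Continuous.matrix_vecMul continuous_const continuous_id)

theorem summable_pow_mul_of_le [Fintype l] [DecidableEq l] {R : Matrix l l ℝ}
    (hR : ∀ i j, 0 ≤ R i j) (hs : Summable fun n : ℕ => R ^ n) {C : ℕ → Matrix l l ℝ} {c : ℝ}
    (hC : ∀ n i j, 0 ≤ C n i j) (hCc : ∀ n i j, C n i j ≤ c) :
    Summable fun n : ℕ => R ^ n * C n :=
  summable_matrix_of_le (g := fun n => R ^ n * Matrix.of fun _ _ => c)
    (fun n => mul_apply_nonneg (pow_apply_nonneg hR n) (hC n))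
    (fun n => mul_apply_mono (pow_apply_nonneg hR n) (hC n) (fun _ _ => le_rfl) (hCc n))
    (hs.mul_right _)

theorem summable_pow_of_vecMul_pow_le [Fintype l] [DecidableEq l] {R : Matrix l l ℝ}
    (hR : ∀ i j, 0 ≤ R i j) {v : l → ℝ} (hv : ∀ i, 0 < v i) {y : ℕ → l → ℝ} (hy : Summable y)
    (hle : ∀ n, v ᵥ* R ^ n ≤ y n) : Summable fun n : ℕ => R ^ n := by
  refine summable_matrix_iff.2 fun i j => ?_
  refine Summable.of_nonneg_of_le (fun n => pow_apply_nonneg hR n i j) (fun n => ?_)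
    ((Pi.summable.1 hy j).mul_left (v i)⁻¹)
  rw [inv_mul_eq_div, le_div_iff₀' (hv i)]
  calc v i * (R ^ n) i j ≤ ∑ a, v a * (R ^ n) a j :=
        Finset.single_le_sum (f := fun a => v a * (R ^ n) a j)
          (fun a _ => mul_nonneg (hv a).le (pow_apply_nonneg hR n a j)) (Finset.mem_univ i)
    _ ≤ y n j := hle n j

theorem isUnit_one_sub_of_summable_pow [Ring α] [TopologicalSpace α] [IsTopologicalRing α]
    [T2Space α] {r : α} (hs : Summable fun n : ℕ => r ^ n) : IsUnit (1 - r) :=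
  isUnit_iff_exists.2 ⟨_, hs.one_sub_mul_tsum_pow, hs.tsum_pow_mul_one_sub⟩

theorem hasSum_sum_inr [Fintype l] [Fintype m] [AddCommGroup α] [UniformSpace α]
    [IsUniformAddGroup α] [CompleteSpace α] [T2Space α] {f : l ⊕ k × m → α} {a : α}
    (hf : HasSum f a) : HasSum (fun n => ∑ j, f (Sum.inr (n, j))) (a - ∑ i, f (Sum.inl i)) := by
  have hinr : Summable (f ∘ Sum.inr) := hf.summable.comp_injective Sum.inr_injective
  have ha : a = ∑ i, f (Sum.inl i) + ∑' p, (f ∘ Sum.inr) p :=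
    hf.unique ((hasSum_fintype (f ∘ Sum.inl)).sum hinr.hasSum)
  rw [ha, add_sub_cancel_left]
  exact hinr.hasSum.prod_fiberwise fun _ => hasSum_fintype _

end Sums

/-! ### Excessive measures of irreducible stochastic matrices -/

section Chain

variable {S : Type*} {P : Matrix S S ℝ} {d : S → ℝ}

theorem mem_of_isIrreducible (hP : P.IsIrreducible) {C : Set S}
    (hC : ∀ s ∈ C, ∀ t, 0 < P s t → t ∈ C) {s : S} (hs : s ∈ C) (t : S) : t ∈ C := by
  let : Quiver S := Matrix.toQuiver P
  obtain ⟨p, -⟩ := hP.connected s t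
  induction p with
  | nil => exact hs
  | cons _ e ih => exact hC _ ih _ e.down

theorem eq_zero_or_forall_pos_of_invariant (hP : P.IsIrreducible) (hd₀ : 0 ≤ d)
    (hd : ∀ t, HasSum (fun s => d s * P s t) (d t)) : d = 0 ∨ ∀ t, 0 < d t := by
  refine or_iff_not_imp_left.2 fun hne => ?_
  obtain ⟨s, hs⟩ := Function.ne_iff.1 hne
  refine mem_of_isIrreducible hP (C := {s | 0 < d s}) (fun s hs t hst => ?_)
    ((hd₀ s).lt_of_ne' hs)
  exact (mul_pos hs hst).trans_le
    (le_hasSum (hd t) s fun u _ => mul_nonneg (hd₀ u) (hP.nonneg u t))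

theorem IsStationary.pos (hP : P.IsIrreducible) {x : S → ℝ} (hx : IsStationary P x) :
    ∀ t, 0 < x t := by
  refine (eq_zero_or_forall_pos_of_invariant hP hx.1 hx.2.2).resolve_left ?_
  rintro rfl
  exact zero_ne_one (hasSum_zero.unique hx.2.1)

theorem IsStochastic.le_one (hP : IsStochastic P) (s t : S) : P s t ≤ 1 :=
  le_hasSum (hP.2 s) t fun u _ => hP.1 s u

theorem IsStochastic.hasSum_mul_row (hP : IsStochastic P) (d : S → ℝ) (s : S) :
    HasSum (fun t => d s * P s t) (d s) := by
  simpa using (hP.2 s).mul_left (d s)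

theorem IsStochastic.summable_mul_prod (hP : IsStochastic P) (hd₀ : 0 ≤ d) (hds : Summable d) :
    Summable fun p : S × S => d p.1 * P p.1 p.2 :=
  (summable_prod_of_nonneg fun p => mul_nonneg (hd₀ p.1) (hP.1 p.1 p.2)).2
    ⟨fun s => (hP.hasSum_mul_row d s).summable, by
      simpa only [(hP.hasSum_mul_row d _).tsum_eq] using hds⟩

theorem IsStochastic.summable_mul_column (hP : IsStochastic P) (hd₀ : 0 ≤ d) (hds : Summable d)
    (t : S) : Summable fun s => d s * P s t :=
  (hP.summable_mul_prod hd₀ hds).prod_symm.prod_factor t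

theorem IsStochastic.hasSum_mul_column_of_le (hP : IsStochastic P) (hd₀ : 0 ≤ d)
    (hds : Summable d) (hle : ∀ t, d t ≤ ∑' s, d s * P s t) (t : S) :
    HasSum (fun s => d s * P s t) (d t) := by
  have hcol := hP.summable_mul_column hd₀ hds
  have hprod := hP.summable_mul_prod hd₀ hds
  have hmass : ∑' t, ∑' s, d s * P s t = ∑' s, d s := by
    rw [hprod.tsum_comm]
    exact tsum_congr fun s => (hP.hasSum_mul_row d s).tsum_eq
  have hdefect : HasSum (fun t => ∑' s, d s * P s t - d t) 0 := by
    have hsum : HasSum (fun t => ∑' s, d s * P s t) (∑' t, ∑' s, d s * P s t) :=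
      hprod.prod_symm.prod.hasSum
    simpa only [hmass, sub_self] using hsum.sub hds.hasSum
  have hzero := (hasSum_zero_iff_of_nonneg fun t => sub_nonneg.2 (hle t)).1 hdefect
  rw [← sub_eq_zero.1 (congrFun hzero t)]
  exact (hcol t).hasSum

theorem IsStochastic.eq_zero_of_le_tsum (hP : IsStochastic P) (hirr : P.IsIrreducible)
    (hd₀ : 0 ≤ d) (hds : Summable d) (hle : ∀ t, d t ≤ ∑' s, d s * P s t) {s : S}
    (hs : d s = 0) : d = 0 :=
  (eq_zero_or_forall_pos_of_invariant hirr hd₀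
    (hP.hasSum_mul_column_of_le hd₀ hds hle)).resolve_right fun hpos => (hpos s).ne' hs

end Chain

/-! ### The minimal solution as a limit of successive approximations -/

section Iterates

variable {ι : Type*} [Fintype ι] [DecidableEq ι] {A : ℕ → Matrix ι ι ℝ} {R X : Matrix ι ι ℝ}

/-- The map `X ↦ ∑_k X ^ k A_k`, whose minimal nonnegative fixed point is the matrix `R` of the
chain. Its value is meaningful only where the series converges. -/
noncomputable def powSeries (A : ℕ → Matrix ι ι ℝ) (X : Matrix ι ι ℝ) : Matrix ι ι ℝ :=
  ∑' k : ℕ, X ^ k * A k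

theorem summable_pow_mul_of_le_summable (hA : ∀ k i j, 0 ≤ A k i j)
    (hR : Summable fun k : ℕ => R ^ k * A k) (hX : ∀ i j, 0 ≤ X i j)
    (hXR : ∀ i j, X i j ≤ R i j) : Summable fun k : ℕ => X ^ k * A k :=
  summable_matrix_of_le (fun k => mul_apply_nonneg (pow_apply_nonneg hX k) (hA k))
    (fun k => pow_mul_apply_mono (hA k) hX hXR) hR

theorem powSeries_nonneg (hA : ∀ k i j, 0 ≤ A k i j) (hX : ∀ i j, 0 ≤ X i j)
    (hs : Summable fun k : ℕ => X ^ k * A k) (i j : ι) : 0 ≤ powSeries A X i j :=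
  (hasSum_matrix_iff.1 hs.hasSum i j).nonneg fun k =>
    mul_apply_nonneg (pow_apply_nonneg hX k) (hA k) i j

theorem powSeries_mono (hA : ∀ k i j, 0 ≤ A k i j) (hR : Summable fun k : ℕ => R ^ k * A k)
    (hX : ∀ i j, 0 ≤ X i j) (hXR : ∀ i j, X i j ≤ R i j) (i j : ι) :
    powSeries A X i j ≤ powSeries A R i j :=
  hasSum_le (fun k => pow_mul_apply_mono (hA k) hX hXR i j)
    (hasSum_matrix_iff.1 (summable_pow_mul_of_le_summable hA hR hX hXR).hasSum i j)
    (hasSum_matrix_iff.1 hR.hasSum i j)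

theorem tendsto_powSeries {α : Type*} {l : Filter α} {Y : α → Matrix ι ι ℝ}
    (hA : ∀ k i j, 0 ≤ A k i j) (hR : Summable fun k : ℕ => R ^ k * A k)
    (hY₀ : ∀ a i j, 0 ≤ Y a i j) (hYR : ∀ a i j, Y a i j ≤ R i j) (hY : Tendsto Y l (𝓝 X)) :
    Tendsto (fun a => powSeries A (Y a)) l (𝓝 (powSeries A X)) := by
  rcases l.eq_or_neBot with rfl | _
  · exact tendsto_bot
  have hentry (i j : ι) : Tendsto (fun a => Y a i j) l (𝓝 (X i j)) :=
    ((continuous_id.matrix_elem i j).tendsto X).comp hY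
  have hX₀ (i j : ι) : 0 ≤ X i j := ge_of_tendsto' (hentry i j) fun a => hY₀ a i j
  have hXR (i j : ι) : X i j ≤ R i j := le_of_tendsto' (hentry i j) fun a => hYR a i j
  refine tendsto_pi_nhds.2 fun i => tendsto_pi_nhds.2 fun j => ?_
  have htsum {Z : Matrix ι ι ℝ} (hZ₀ : ∀ i j, 0 ≤ Z i j) (hZR : ∀ i j, Z i j ≤ R i j) :
      powSeries A Z i j = ∑' k : ℕ, (Z ^ k * A k) i j :=
    (hasSum_matrix_iff.1 (summable_pow_mul_of_le_summable hA hR hZ₀ hZR).hasSum i j).tsum_eq.symm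
  simp only [htsum hX₀ hXR, htsum (hY₀ _) (hYR _)]
  refine tendsto_tsum_of_dominated_convergence (summable_matrix_iff.1 hR i j) (fun k => ?_)
    (.of_forall fun a k => ?_)
  · exact ((((continuous_id.pow k).matrix_mul continuous_const).matrix_elem i j).tendsto X).comp hY
  · rw [Real.norm_of_nonneg (mul_apply_nonneg (pow_apply_nonneg (hY₀ a) k) (hA k) i j)]
    exact pow_mul_apply_mono (hA k) (hY₀ a) (hYR a) i j

theorem iterate_powSeries_bounds (hA : ∀ k i j, 0 ≤ A k i j) (hR₀ : ∀ i j, 0 ≤ R i j)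
    (hR : HasSum (fun k : ℕ => R ^ k * A k) R) (n : ℕ) :
    (∀ i j, 0 ≤ (powSeries A)^[n] 0 i j) ∧ ∀ i j, (powSeries A)^[n] 0 i j ≤ R i j := by
  induction n with
  | zero => exact ⟨fun _ _ => le_rfl, hR₀⟩
  | succ n ih =>
    rw [Function.iterate_succ_apply']
    refine ⟨powSeries_nonneg hA ih.1
      (summable_pow_mul_of_le_summable hA hR.summable ih.1 ih.2), fun i j => ?_⟩
    exact (powSeries_mono hA hR.summable ih.1 ih.2 i j).trans_eq
      (congrFun (congrFun hR.tsum_eq i) j)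

theorem iterate_powSeries_le_succ (hA : ∀ k i j, 0 ≤ A k i j) (hR₀ : ∀ i j, 0 ≤ R i j)
    (hR : HasSum (fun k : ℕ => R ^ k * A k) R) (n : ℕ) :
    ∀ i j, (powSeries A)^[n] 0 i j ≤ (powSeries A)^[n + 1] 0 i j := by
  have hbounds := iterate_powSeries_bounds hA hR₀ hR
  induction n with
  | zero => exact (hbounds 1).1
  | succ n ih =>
    have hsum := summable_pow_mul_of_le_summable hA hR.summable (hbounds (n + 1)).1
      (hbounds (n + 1)).2
    simpa only [Function.iterate_succ_apply'] using powSeries_mono hA hsum (hbounds n).1 ih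

end Iterates

/-! ### Balance equations -/

section Balanced

variable {ι : Type*} [Fintype ι] {A : ℕ → Matrix ι ι ℝ} {y z : ℕ → ι → ℝ}

/-- The balance equations at the levels `k + 2`, `k ≥ 0`, for a sequence of row vectors `y` whose
entry `y k` is the subvector of level `k + 1`. -/
def IsBalanced (A : ℕ → Matrix ι ι ℝ) (y : ℕ → ι → ℝ) : Prop :=
  ∀ k, HasSum (fun n => y (k + n) ᵥ* A n) (y (k + 1))

theorem IsBalanced.sub (hy : IsBalanced A y) (hz : IsBalanced A z) : IsBalanced A (y - z) :=
  fun k => by simpa only [Pi.sub_apply, Matrix.sub_vecMul] using (hy k).sub (hz k)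

variable [DecidableEq ι] {X R : Matrix ι ι ℝ}

theorem isBalanced_vecMul_pow (hR : HasSum (fun k : ℕ => R ^ k * A k) R) (v : ι → ℝ) :
    IsBalanced A fun k => v ᵥ* R ^ k := fun k => by
  simpa only [pow_add, pow_one, Matrix.vecMul_vecMul, Matrix.mul_assoc] using
    hasSum_vecMul hR (v ᵥ* R ^ k)

theorem IsBalanced.vecMul_powSeries_le (hA : ∀ k i j, 0 ≤ A k i j) (hy₀ : 0 ≤ y)
    (hy : IsBalanced A y) (hX₀ : ∀ i j, 0 ≤ X i j) (hX : Summable fun k : ℕ => X ^ k * A k)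
    (hle : ∀ k, y k ᵥ* X ≤ y (k + 1)) (k : ℕ) : y k ᵥ* powSeries A X ≤ y (k + 1) := by
  refine hasSum_le (fun n => ?_) (hasSum_vecMul hX.hasSum (y k)) (hy k)
  rw [← Matrix.vecMul_vecMul]
  exact vecMul_mono (hy₀ (k + n)) (hA n) (vecMul_pow_le_of_vecMul_le_succ hX₀ hy₀ hle k n)
    fun _ _ => le_rfl

theorem IsBalanced.vecMul_iterate_powSeries_le (hA : ∀ k i j, 0 ≤ A k i j) (hy₀ : 0 ≤ y)
    (hy : IsBalanced A y) (hR₀ : ∀ i j, 0 ≤ R i j) (hR : HasSum (fun k : ℕ => R ^ k * A k) R)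
    (n : ℕ) : ∀ k, y k ᵥ* (powSeries A)^[n] 0 ≤ y (k + 1) := by
  induction n with
  | zero =>
    intro k
    rw [Function.iterate_zero_apply, Matrix.vecMul_zero]
    exact hy₀ (k + 1)
  | succ n ih =>
    obtain ⟨hpos, hle⟩ := iterate_powSeries_bounds hA hR₀ hR n
    rw [Function.iterate_succ_apply']
    exact hy.vecMul_powSeries_le hA hy₀ hpos
      (summable_pow_mul_of_le_summable hA hR.summable hpos hle) ih

end Balanced

variable {m₀ m : ℕ} {B₁ : Matrix (Fin m₀) (Fin m₀) ℝ} {B₀ : Matrix (Fin m₀) (Fin m) ℝ}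
  {B : ℕ → Matrix (Fin m) (Fin m₀) ℝ} {A : ℕ → Matrix (Fin m) (Fin m) ℝ}
  {R : Matrix (Fin m) (Fin m) ℝ} {x : State m₀ m → ℝ} {y : ℕ → Fin m → ℝ}

theorem IsMinimalSolution.tendsto_iterate_powSeries (hA : ∀ k i j, 0 ≤ A k i j)
    (hR : IsMinimalSolution A R) : Tendsto (fun n => (powSeries A)^[n] 0) atTop (𝓝 R) := by
  obtain ⟨hR₀, hRsum, hmin⟩ := hR
  have hbounds := iterate_powSeries_bounds hA hR₀ hRsum
  obtain ⟨Y, hYij⟩ : ∃ Y : Matrix (Fin m) (Fin m) ℝ, ∀ i j,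
      Tendsto (fun n => (powSeries A)^[n] 0 i j) atTop (𝓝 (Y i j)) :=
    ⟨_, fun i j => tendsto_atTop_ciSup
      (monotone_nat_of_le_succ fun n => iterate_powSeries_le_succ hA hR₀ hRsum n i j)
      ⟨R i j, Set.forall_mem_range.2 fun n => (hbounds n).2 i j⟩⟩
  have hY : Tendsto (fun n => (powSeries A)^[n] 0) atTop (𝓝 Y) :=
    tendsto_pi_nhds.2 fun i => tendsto_pi_nhds.2 fun j => hYij i j
  have hY₀ (i j : Fin m) : 0 ≤ Y i j := ge_of_tendsto' (hYij i j) fun n => (hbounds n).1 i j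
  have hYR (i j : Fin m) : Y i j ≤ R i j := le_of_tendsto' (hYij i j) fun n => (hbounds n).2 i j
  have hnext : Tendsto (fun n => powSeries A ((powSeries A)^[n] 0)) atTop (𝓝 Y) := by
    simpa only [Function.iterate_succ_apply'] using (tendsto_add_atTop_iff_nat 1).2 hY
  have hfixed : powSeries A Y = Y :=
    tendsto_nhds_unique (tendsto_powSeries hA hRsum.summable (fun n => (hbounds n).1)
      (fun n => (hbounds n).2) hY) hnext
  have hYsum : HasSum (fun k : ℕ => Y ^ k * A k) (powSeries A Y) :=
    (summable_pow_mul_of_le_summable hA hRsum.summable hY₀ hYR).hasSum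
  rw [hfixed] at hYsum
  have hYeq : Y = R :=
    Matrix.ext fun i j => (hYR i j).antisymm (hmin Y hY₀ hYsum i j)
  exact hYeq ▸ hY

theorem IsBalanced.vecMul_le_succ (hA : ∀ k i j, 0 ≤ A k i j) (hR : IsMinimalSolution A R)
    (hy₀ : 0 ≤ y) (hy : IsBalanced A y) (k : ℕ) : y k ᵥ* R ≤ y (k + 1) :=
  le_of_tendsto' (((Continuous.matrix_vecMul continuous_const continuous_id).tendsto R).comp
      (hR.tendsto_iterate_powSeries hA))
    fun n => hy.vecMul_iterate_powSeries_le hA hy₀ hR.1 hR.2.1 n k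

theorem IsBalanced.vecMul_pow_le (hA : ∀ k i j, 0 ≤ A k i j) (hR : IsMinimalSolution A R)
    (hy₀ : 0 ≤ y) (hy : IsBalanced A y) (k : ℕ) : y 0 ᵥ* R ^ k ≤ y k := by
  simpa only [zero_add] using
    vecMul_pow_le_of_vecMul_le_succ hR.1 hy₀ (hy.vecMul_le_succ hA hR hy₀) 0 k

/-! ### The chain of GI/M/1 type -/

section Transition

theorem transition_inr_inr_add (k n : ℕ) (i j : Fin m) :
    transition B₁ B₀ B A (Sum.inr (k + n, i)) (Sum.inr (n + 1, j)) = A k i j := by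
  simp only [transition]
  rw [if_pos (by omega), show k + n + 1 - (n + 1) = k by omega]

theorem transition_inr_succ_inr_succ (k n : ℕ) (i j : Fin m) :
    transition B₁ B₀ B A (Sum.inr (k + 1, i)) (Sum.inr (n + 1, j)) =
      transition B₁ B₀ B A (Sum.inr (k, i)) (Sum.inr (n, j)) := by
  simp only [transition, Nat.add_le_add_iff_right, Nat.add_sub_add_right]

theorem IsStochastic.block_nonneg (hP : IsStochastic (transition B₁ B₀ B A)) (k : ℕ)
    (i j : Fin m) : 0 ≤ A k i j :=
  (hP.1 _ _).trans_eq (transition_inr_inr_add k 0 i j)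

theorem IsStochastic.block_le_one (hP : IsStochastic (transition B₁ B₀ B A)) (k : ℕ)
    (i j : Fin m) : A k i j ≤ 1 :=
  (transition_inr_inr_add k 0 i j).symm.trans_le (hP.le_one _ _)

/-- Without phases in level `0`, the rows of the levels `n + 1` and `n + 2` have the same sum and
differ by a shift, which leaves no mass for the additional entries of the latter. -/
theorem transition_inr_succ_inr_zero {B₁ : Matrix (Fin 0) (Fin 0) ℝ} {B₀ : Matrix (Fin 0) (Fin m) ℝ}
    {B : ℕ → Matrix (Fin m) (Fin 0) ℝ} (hP : IsStochastic (transition B₁ B₀ B A)) (n : ℕ)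
    (i j : Fin m) : transition B₁ B₀ B A (Sum.inr (n + 1, i)) (Sum.inr (0, j)) = 0 := by
  have hrow (k : ℕ) : HasSum
      (fun l => ∑ j, transition B₁ B₀ B A (Sum.inr (k, i)) (Sum.inr (l, j))) 1 := by
    simpa using hasSum_sum_inr (hP.2 (Sum.inr (k, i)))
  have hshift := (hasSum_nat_add_iff' 1).2 (hrow (n + 1))
  simp only [transition_inr_succ_inr_succ, Finset.sum_range_one] at hshift
  have hzero := sub_eq_self.1 (hshift.unique (hrow n))
  exact (Finset.sum_eq_zero_iff_of_nonneg fun j _ => hP.1 _ _).1 hzero j (Finset.mem_univ j)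

theorem levelZero_dim_pos (hP : IsStochastic (transition B₁ B₀ B A))
    (hirr : (transition B₁ B₀ B A).IsIrreducible) (i : Fin m) : 0 < m₀ := by
  refine Nat.pos_of_ne_zero ?_
  rintro rfl
  have hclosed : ∀ s ∈ {s : State 0 m | ∃ n j, s = Sum.inr (n + 1, j)}, ∀ t,
      0 < transition B₁ B₀ B A s t → t ∈ {s : State 0 m | ∃ n j, s = Sum.inr (n + 1, j)} := by
    rintro _ ⟨n, j, rfl⟩ (t | ⟨_ | l, t⟩) hst
    · exact t.elim0
    · exact absurd (transition_inr_succ_inr_zero hP n j t) hst.ne'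
    · exact ⟨l, t, rfl⟩
  obtain ⟨n, j, h⟩ := mem_of_isIrreducible hirr hclosed ⟨0, i, rfl⟩ (Sum.inr (0, i))
  simp at h

theorem hasSum_level_vecMul_succ {a : Fin m → ℝ}
    (h : ∀ j, HasSum (fun s => x s * transition B₁ B₀ B A s (Sum.inr (0, j))) (a j)) :
    HasSum (fun n => level x (n + 1) ᵥ* A (n + 1)) (a - levelZero x ᵥ* B₀) :=
  Pi.hasSum.2 fun j => hasSum_sum_inr (h j)

theorem hasSum_level_vecMul {k : ℕ} {a : Fin m → ℝ}
    (h : ∀ j, HasSum (fun s => x s * transition B₁ B₀ B A s (Sum.inr (k + 1, j))) (a j)) :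
    HasSum (fun n => level x (k + n + 1) ᵥ* A n) a := by
  refine Pi.hasSum.2 fun j => ?_
  have hskip : ∑ n ∈ Finset.range k, ∑ i, x (Sum.inr (n, i)) *
      transition B₁ B₀ B A (Sum.inr (n, i)) (Sum.inr (k + 1, j)) = 0 := by
    refine Finset.sum_eq_zero fun n hn => Finset.sum_eq_zero fun i _ => ?_
    have hnk : ¬k + 1 ≤ n + 1 := by simpa using hn
    simp only [transition, if_neg hnk, mul_zero]
  have hfrom := (hasSum_nat_add_iff' k).2 (hasSum_sum_inr (h j))
  simp only [hskip, transition_inr_inr_add, sub_zero] at hfrom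
  simpa [transition, add_comm, level, Matrix.vecMul, dotProduct] using hfrom

theorem IsStationary.isBalanced (hx : IsStationary (transition B₁ B₀ B A) x) :
    IsBalanced A fun k => level x (k + 1) :=
  fun k => hasSum_level_vecMul fun j => hx.2.2 (Sum.inr (k + 1, j))

theorem summable_level (hx : Summable x) : Summable fun n : ℕ => level x (n + 1) :=
  Pi.summable.2 fun j => hx.comp_injective (i := fun n : ℕ => (Sum.inr (n, j) : State m₀ m))
    (Sum.inr_injective.comp (Prod.mk_left_injective j))

end Transition

/-! ### Uniqueness for the balance equations -/

section Uniqueness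

/-- The vector with subvector `0` at level `0` and `y k` at level `k + 1`. -/
def ofLevels (m₀ : ℕ) (y : ℕ → Fin m → ℝ) : State m₀ m → ℝ :=
  Sum.elim 0 fun p => y p.1 p.2

theorem ofLevels_nonneg (hy₀ : 0 ≤ y) : 0 ≤ ofLevels m₀ y
  | Sum.inl _ => le_rfl
  | Sum.inr (k, j) => hy₀ k j

theorem summable_ofLevels (hy₀ : 0 ≤ y) (hys : Summable y) : Summable (ofLevels m₀ y) := by
  have hinr : Summable fun p : ℕ × Fin m => y p.1 p.2 := by
    refine (summable_prod_of_nonneg fun p => hy₀ p.1 p.2).2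
      ⟨fun k => (hasSum_fintype _).summable, ?_⟩
    simpa only [tsum_fintype] using summable_sum fun j _ => Pi.summable.1 hys j
  exact (hasSum_zero.sum (f := ofLevels m₀ y) hinr.hasSum).summable

theorem IsBalanced.ofLevels_le_tsum (hP : IsStochastic (transition B₁ B₀ B A))
    (hy : IsBalanced A y) (hy₀ : 0 ≤ y) (hys : Summable y)
    (hle : y 0 ≤ ∑' n, y n ᵥ* A (n + 1)) (t : State m₀ m) :
    ofLevels m₀ y t ≤ ∑' s, ofLevels m₀ y s * transition B₁ B₀ B A s t := by
  have hcol (t : State m₀ m) :=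
    (hP.summable_mul_column (ofLevels_nonneg hy₀) (summable_ofLevels hy₀ hys) t).hasSum
  rcases t with i | ⟨_ | k, j⟩
  · exact tsum_nonneg fun s => mul_nonneg (ofLevels_nonneg hy₀ s) (hP.1 _ _)
  · have hzero := hasSum_level_vecMul_succ fun j => hcol (Sum.inr (0, j))
    rw [show levelZero (ofLevels m₀ y) = 0 from rfl, Matrix.zero_vecMul, sub_zero] at hzero
    exact (hle j).trans_eq (congrFun hzero.tsum_eq j)
  · have hsucc := hasSum_level_vecMul fun j => hcol (Sum.inr (k + 1, j))
    exact (congrFun ((hy k).unique hsucc) j).le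

theorem IsBalanced.eq_zero_of_le_tsum (hP : IsStochastic (transition B₁ B₀ B A))
    (hirr : (transition B₁ B₀ B A).IsIrreducible) (hy : IsBalanced A y) (hy₀ : 0 ≤ y)
    (hys : Summable y) (hle : y 0 ≤ ∑' n, y n ᵥ* A (n + 1)) : y = 0 := by
  funext k j
  have hzero : ofLevels m₀ y = 0 :=
    hP.eq_zero_of_le_tsum hirr (ofLevels_nonneg hy₀) (summable_ofLevels hy₀ hys)
      (hy.ofLevels_le_tsum hP hy₀ hys hle) (s := Sum.inl ⟨0, levelZero_dim_pos hP hirr j⟩) rfl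
  exact congrFun hzero (Sum.inr (k, j))

theorem IsBalanced.eq_vecMul_pow (hP : IsStochastic (transition B₁ B₀ B A))
    (hirr : (transition B₁ B₀ B A).IsIrreducible) (hR : IsMinimalSolution A R)
    (hy : IsBalanced A y) (hy₀ : 0 ≤ y) (hys : Summable y) (k : ℕ) : y k = y 0 ᵥ* R ^ k := by
  have hdiff₀ : 0 ≤ y - fun k => y 0 ᵥ* R ^ k := fun k =>
    sub_nonneg.2 (hy.vecMul_pow_le hP.block_nonneg hR hy₀ k)
  have hdiffs : Summable (y - fun k => y 0 ᵥ* R ^ k) := Pi.summable.2 fun j =>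
    Summable.of_nonneg_of_le (fun k => hdiff₀ k j)
      (fun k => sub_le_self _ (vecMul_nonneg (hy₀ 0) (pow_apply_nonneg hR.1 k) j))
      (Pi.summable.1 hys j)
  have hzero := (hy.sub (isBalanced_vecMul_pow hR.2.1 (y 0))).eq_zero_of_le_tsum hP hirr hdiff₀
    hdiffs (by
      simpa using tsum_nonneg fun n => vecMul_nonneg (hdiff₀ n) (hP.block_nonneg (n + 1)))
  exact sub_eq_zero.1 (congrFun hzero k)

theorem isUnit_one_sub_psiHat (hP : IsStochastic (transition B₁ B₀ B A))
    (hirr : (transition B₁ B₀ B A).IsIrreducible) (hR₀ : ∀ i j, 0 ≤ R i j)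
    (hR : HasSum (fun k : ℕ => R ^ k * A k) R) (hs : Summable fun n : ℕ => R ^ n) :
    IsUnit (1 - psiHat A R) := by
  have hψ : Summable fun k : ℕ => R ^ k * A (k + 1) :=
    summable_pow_mul_of_le hR₀ hs (fun k => hP.block_nonneg _) (fun k => hP.block_le_one _)
  by_contra hunit
  obtain ⟨v, hv₀, hv, hle⟩ := exists_le_vecMul_of_not_isUnit_one_sub
    (fun i j => (hasSum_matrix_iff.1 hψ.hasSum i j).nonneg fun k =>
      mul_apply_nonneg (pow_apply_nonneg hR₀ k) (hP.block_nonneg _) i j) hunit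
  refine hv ?_
  have hzero := (isBalanced_vecMul_pow hR v).eq_zero_of_le_tsum hP hirr
    (fun k => vecMul_nonneg hv₀ (pow_apply_nonneg hR₀ k)) (hasSum_vecMul hs.hasSum v).summable (by
      simpa only [pow_zero, Matrix.vecMul_one, Matrix.vecMul_vecMul, add_zero,
        (hasSum_vecMul hψ.hasSum v).tsum_eq] using hle)
  simpa using congrFun hzero 0

end Uniqueness

/-! ### The `U`- and `G`-measures and the factorization -/

section Factorization

theorem hasSum_mul_psiSum {n : ℕ} (hψ : Summable fun k : ℕ => R ^ k * A (k + n + 1)) :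
    HasSum (fun k : ℕ => R * R ^ k * A (k + n + 1)) (R * psiSum A R n) := by
  simp only [Matrix.mul_assoc]
  exact hψ.hasSum.mul_left R

theorem psiSum_eq_add_mul {n : ℕ} (hψ : Summable fun k : ℕ => R ^ k * A (k + (n + 1) + 1)) :
    psiSum A R n = A (n + 1) + R * psiSum A R (n + 1) := by
  have hshift : HasSum (fun k : ℕ => R ^ (k + 1) * A (k + 1 + n + 1))
      (R * psiSum A R (n + 1)) := by
    simpa only [pow_succ', add_assoc, add_left_comm] using hasSum_mul_psiSum hψ
  have hsum := (hasSum_nat_add_iff (f := fun k : ℕ => R ^ k * A (k + n + 1)) 1).1 hshift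
  rw [psiSum, hsum.tsum_eq, add_comm, Finset.sum_range_one, pow_zero, Matrix.one_mul, zero_add]

theorem eq_add_mul_psiHat (hR : HasSum (fun k : ℕ => R ^ k * A k) R)
    (hψ : Summable fun k : ℕ => R ^ k * A (k + 1)) : R = A 0 + R * psiHat A R := by
  have hshift : HasSum (fun k : ℕ => R ^ (k + 1) * A (k + 1)) (R * psiHat A R) := by
    rw [psiHat]
    simpa only [pow_succ', add_zero] using hasSum_mul_psiSum (n := 0) hψ
  have hsum := (hasSum_nat_add_iff (f := fun k : ℕ => R ^ k * A k) 1).1 hshift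
  rw [Finset.sum_range_one, pow_zero, Matrix.one_mul, add_comm] at hsum
  exact hR.unique hsum

theorem psiHatZero_eq_add (hψ : Summable fun k : ℕ => R ^ k * A (k + 2)) :
    psiHatZero A R = A 0 + psiHat A R := by
  rw [psiHatZero, (hasSum_mul_psiSum hψ).tsum_eq, psiHat, psiSum_eq_add_mul hψ, add_assoc]

theorem one_sub_psiHatZero (hR : HasSum (fun k : ℕ => R ^ k * A k) R)
    (hψ : ∀ n : ℕ, Summable fun k : ℕ => R ^ k * A (k + n + 1)) :
    1 - psiHatZero A R = (1 - R) * (1 - psiHat A R) := by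
  have hR' : R * psiHat A R = R - A 0 := eq_sub_of_add_eq' (eq_add_mul_psiHat hR (hψ 0)).symm
  rw [psiHatZero_eq_add (hψ 1), sub_mul, one_mul, mul_sub, mul_one, hR']
  abel

theorem mul_inv_one_sub_psiHatZero (hzero : 1 - psiHatZero A R = (1 - R) * (1 - psiHat A R)) :
    B₀ * (1 - psiHatZero A R)⁻¹ = rOne B₀ A R * (1 - R)⁻¹ := by
  rw [hzero, Matrix.mul_inv_rev, rOne, Matrix.mul_assoc]

theorem blockMul_one_sub_diagPsi (M : BlockMatrix m) (i j : ℕ) :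
    blockMul M (1 - diagPsi A R) i j =
      M i j * (1 - if j = 0 then psiHatZero A R else psiHat A R) := by
  rw [blockMul, tsum_eq_single j fun k hk => ?_]
  · simp [diagPsi]
  · simp [diagPsi, Matrix.one_apply_ne hk, Matrix.diagonal_apply_ne _ hk]

theorem blockMul_one_sub_upperR_one_sub_diagPsi (M : BlockMatrix m) (i j : ℕ) :
    blockMul (blockMul (1 - upperR R) (1 - diagPsi A R)) M i j =
      (1 - if i = 0 then psiHatZero A R else psiHat A R) * M i j -
        R * ((1 - psiHat A R) * M (i + 1) j) := by
  rw [blockMul, tsum_eq_sum (s := {i, i + 1}) fun k hk => ?_]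
  · rw [Finset.sum_pair (by omega), blockMul_one_sub_diagPsi, blockMul_one_sub_diagPsi]
    simp [upperR, Matrix.mul_assoc, sub_eq_add_neg]
  · simp only [Finset.mem_insert, Finset.mem_singleton, not_or] at hk
    simp [blockMul_one_sub_diagPsi, upperR, Matrix.one_apply_ne (Ne.symm hk.1), hk.2]

theorem one_sub_psiHat_mul_one_sub_lowerG (hunit : IsUnit (1 - psiHat A R)) (i j : ℕ) :
    (1 - psiHat A R) * (1 - lowerG A R) i j =
      if j < i then -psiSum A R (i - j) else if j = i then 1 - psiHat A R else 0 := by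
  have hcancel (M : Matrix (Fin m) (Fin m) ℝ) :
      (1 - psiHat A R) * ((1 - psiHat A R)⁻¹ * M) = M :=
    Matrix.mul_nonsing_inv_cancel_left _ _ ((Matrix.isUnit_iff_isUnit_det _).1 hunit)
  rcases lt_trichotomy j i with hji | rfl | hij
  · simp [lowerG, hji, Matrix.one_apply_ne hji.ne', hcancel]
  · simp [lowerG]
  · simp [lowerG, hij.not_gt, hij.ne', Matrix.one_apply_ne hij.ne]

theorem one_sub_tailMatrix_eq (hR : HasSum (fun k : ℕ => R ^ k * A k) R)
    (hψ : ∀ n : ℕ, Summable fun k : ℕ => R ^ k * A (k + n + 1))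
    (hunit : IsUnit (1 - psiHat A R)) :
    1 - tailMatrix A =
      blockMul (blockMul (1 - upperR R) (1 - diagPsi A R)) (1 - lowerG A R) := by
  have hA₀ : R * (1 - psiHat A R) = A 0 := by
    rw [Matrix.mul_sub, Matrix.mul_one, sub_eq_iff_eq_add]
    exact eq_add_mul_psiHat hR (hψ 0)
  have hψ₀ : psiHat A R = A 1 + R * psiSum A R 1 := psiSum_eq_add_mul (hψ 1)
  refine funext fun i => funext fun j => ?_
  rw [blockMul_one_sub_upperR_one_sub_diagPsi, one_sub_psiHat_mul_one_sub_lowerG hunit]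
  rcases i with _ | i
  · rcases j with _ | _ | j
    · simp only [Matrix.sub_apply, Matrix.one_apply_eq, tailMatrix, and_self, if_true, lowerG,
        psiHatZero_eq_add (hψ 1), hψ₀, lt_self_iff_false, if_false, sub_zero, mul_one, zero_add,
        zero_lt_one, Matrix.mul_neg]
      abel
    · simp [tailMatrix, lowerG, hA₀]
    · simp [tailMatrix, lowerG]
  · rw [if_neg i.succ_ne_zero, one_sub_psiHat_mul_one_sub_lowerG hunit]
    obtain hj | rfl | rfl | hj : j < i + 1 ∨ j = i + 1 ∨ j = i + 2 ∨ i + 2 < j := by omega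
    · rw [if_pos hj, if_pos (by omega), psiSum_eq_add_mul (n := i + 1 - j) (hψ _),
        ← Nat.sub_add_comm hj.le]
      simp [tailMatrix, Matrix.one_apply_ne hj.ne', (show j ≤ i + 1 + 1 by omega)]
    · simp only [Matrix.sub_apply, Matrix.one_apply_eq, tailMatrix, i.succ_ne_zero, false_and,
        if_false, i.succ.le_succ, if_true, lt_self_iff_false, (i + 1).lt_succ_self,
        add_tsub_cancel_left, hψ₀, Matrix.mul_neg]
      abel
    · simp [tailMatrix, hA₀]
    · rw [if_neg (by omega), if_neg (by omega), if_neg (by omega), if_neg (by omega)]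
      simp [tailMatrix, Matrix.one_apply_ne (show i + 1 ≠ j by omega),
        (show ¬j ≤ i + 1 + 1 by omega)]

end Factorization

section Stationary

theorem IsStationary.summable_pow (hP : IsStochastic (transition B₁ B₀ B A))
    (hirr : (transition B₁ B₀ B A).IsIrreducible) (hx : IsStationary (transition B₁ B₀ B A) x)
    (hR : IsMinimalSolution A R) : Summable fun n : ℕ => R ^ n :=
  summable_pow_of_vecMul_pow_le hR.1 (fun _ => hx.pos hirr _) (summable_level hx.2.1.summable)
    (hx.isBalanced.vecMul_pow_le hP.block_nonneg hR fun _ _ => hx.1 _)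

theorem IsStationary.level_one_eq (hx : IsStationary (transition B₁ B₀ B A) x)
    (hψ : Summable fun k : ℕ => R ^ k * A (k + 1)) (hunit : IsUnit (1 - psiHat A R))
    (hgeo : ∀ k, level x (k + 1) = level x 1 ᵥ* R ^ k) :
    level x 1 = levelZero x ᵥ* rOne B₀ A R := by
  have hfirst : level x 1 - levelZero x ᵥ* B₀ = level x 1 ᵥ* psiHat A R := by
    have hsum := hasSum_vecMul hψ.hasSum (level x 1)
    simp only [← Matrix.vecMul_vecMul, ← hgeo] at hsum
    exact (hasSum_level_vecMul_succ fun j => hx.2.2 (Sum.inr (0, j))).unique hsum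
  have hB₀ : levelZero x ᵥ* B₀ = level x 1 ᵥ* (1 - psiHat A R) := by
    rw [Matrix.vecMul_sub, Matrix.vecMul_one, ← hfirst, sub_sub_cancel]
  rw [rOne, ← Matrix.vecMul_vecMul, hB₀, Matrix.vecMul_vecMul,
    Matrix.mul_nonsing_inv _ ((Matrix.isUnit_iff_isUnit_det _).1 hunit), Matrix.vecMul_one]

theorem IsStationary.level_succ_eq (hP : IsStochastic (transition B₁ B₀ B A))
    (hirr : (transition B₁ B₀ B A).IsIrreducible) (hx : IsStationary (transition B₁ B₀ B A) x)
    (hR : IsMinimalSolution A R) (hψ : Summable fun k : ℕ => R ^ k * A (k + 1))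
    (hunit : IsUnit (1 - psiHat A R)) (k : ℕ) :
    level x (k + 1) = levelZero x ᵥ* (rOne B₀ A R * R ^ k) := by
  have hgeo := hx.isBalanced.eq_vecMul_pow hP hirr hR (fun _ _ => hx.1 _)
    (summable_level hx.2.1.summable)
  rw [← Matrix.vecMul_vecMul, ← hx.level_one_eq hψ hunit hgeo]
  exact hgeo k

theorem hasSum_level_of_eq_vecMul_mul_pow (hs : Summable fun n : ℕ => R ^ n) {v : Fin m₀ → ℝ}
    {M : Matrix (Fin m₀) (Fin m) ℝ} (hgeo : ∀ k, level x (k + 1) = v ᵥ* (M * R ^ k)) (k : ℕ) :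
    HasSum (fun n => level x (k + 1 + n)) (v ᵥ* (M * (1 - R)⁻¹ * R ^ k)) := by
  have hinv : HasSum (fun n : ℕ => R ^ n) (1 - R)⁻¹ := by
    rw [Matrix.inv_eq_right_inv hs.one_sub_mul_tsum_pow]
    exact hs.hasSum
  simpa only [← pow_add, Matrix.vecMul_vecMul, ← Matrix.mul_assoc, ← hgeo, add_comm _ k,
    add_right_comm k _ 1] using hasSum_vecMul (hinv.mul_right (R ^ k)) (v ᵥ* M)

end Stationary

end GIM1

theorem mainTheorem5 (m₀ m : ℕ)
    (B₁ : Matrix (Fin m₀) (Fin m₀) ℝ) (B₀ : Matrix (Fin m₀) (Fin m) ℝ)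
    (B : ℕ → Matrix (Fin m) (Fin m₀) ℝ) (A : ℕ → Matrix (Fin m) (Fin m) ℝ)
    (hP : GIM1.IsStochastic (GIM1.transition B₁ B₀ B A))
    (hirr : (GIM1.transition B₁ B₀ B A).IsIrreducible)
    (hrec : GIM1.IsPositiveRecurrent (GIM1.transition B₁ B₀ B A))
    (x : GIM1.State m₀ m → ℝ) (hx : GIM1.IsStationary (GIM1.transition B₁ B₀ B A) x)
    (R : Matrix (Fin m) (Fin m) ℝ) (hR : GIM1.IsMinimalSolution A R) :
    -- all series and inverses that occur exist
    (∀ n : ℕ, Summable fun k : ℕ => R ^ k * A (k + n + 1)) ∧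
    (Summable fun k : ℕ => R * R ^ k * A (k + 2)) ∧
    IsUnit (1 - R) ∧ IsUnit (1 - GIM1.psiHat A R) ∧ IsUnit (1 - GIM1.psiHatZero A R) ∧
    (∀ k : ℕ, 1 ≤ k → Summable fun n : ℕ => GIM1.level x (k + n)) ∧
    -- the matrix-geometric form of the stationary vector and of its tails
    (∀ k : ℕ, 1 ≤ k →
      GIM1.level x k = GIM1.levelZero x ᵥ* (GIM1.rOne B₀ A R * R ^ (k - 1))) ∧
    (∀ k : ℕ, 1 ≤ k →
      GIM1.tailVec x k =
        GIM1.levelZero x ᵥ* (GIM1.rOne B₀ A R * (1 - R)⁻¹ * R ^ (k - 1))) ∧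
    -- the UL-type RG-factorization
    1 - GIM1.tailMatrix A =
      GIM1.blockMul (GIM1.blockMul (1 - GIM1.upperR R) (1 - GIM1.diagPsi A R))
        (1 - GIM1.lowerG A R) ∧
    -- the tails through the factorization
    (∀ k : ℕ, 1 ≤ k →
      GIM1.tailVec x k =
        GIM1.levelZero x ᵥ* (B₀ * (1 - GIM1.psiHatZero A R)⁻¹ * R ^ (k - 1))) ∧
    -- the comparison of the two forms
    GIM1.levelZero x ᵥ* (B₀ * (1 - GIM1.psiHatZero A R)⁻¹) =
      GIM1.levelZero x ᵥ* (GIM1.rOne B₀ A R * (1 - R)⁻¹) := by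
  have hs := hx.summable_pow hP hirr hR
  have hψ (n : ℕ) : Summable fun k : ℕ => R ^ k * A (k + n + 1) :=
    GIM1.summable_pow_mul_of_le hR.1 hs (fun _ => hP.block_nonneg _) fun _ => hP.block_le_one _
  have hunitR := GIM1.isUnit_one_sub_of_summable_pow hs
  have hunit := GIM1.isUnit_one_sub_psiHat hP hirr hR.1 hR.2.1 hs
  have hzero := GIM1.one_sub_psiHatZero hR.2.1 hψ
  have hlevel := hx.level_succ_eq hP hirr hR (hψ 0) hunit
  have htail := GIM1.hasSum_level_of_eq_vecMul_mul_pow hs hlevel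
  rw [GIM1.mul_inv_one_sub_psiHatZero hzero]
  refine ⟨hψ, (GIM1.hasSum_mul_psiSum (hψ 1)).summable, hunitR, hunit,
    hzero ▸ hunitR.mul hunit, ?_, ?_, ?_, GIM1.one_sub_tailMatrix_eq hR.2.1 hψ hunit, ?_, rfl⟩
  · exact fun | k + 1, _ => (htail k).summable
  · exact fun | k + 1, _ => hlevel k
  · exact fun | k + 1, _ => (htail k).tsum_eq
  · exact fun | k + 1, _ => (htail k).tsum_eq
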